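/- Let $\{0,1\}^n$ label the computational basis of $n$ qubits. For $1\le K\le 2^n$ let $\mathcal E_{\mathrm{rsp}}(n,K)$ be the ensemble of random subset phase states with subset dimension $K$, that is, of the states $$|\psi_{S,f}\rangle=\frac1{\sqrt K}\sum_{x\in S}(-1)^{f(x)}|x\rangle ,$$ where $S\subseteq\{0,1\}^n$ is a uniformly random subset of size $K$ and, independently, $f:\{0,1\}^n\to\{0,1\}$ is a uniformly random function. For a pure $n$-qubit state $\psi$ and $\alpha\ge 0$, the stabilizer Rényi entropy is $M_\alpha(\psi)=S_\alpha(\Xi_\psi)-\log_2 2^n$, where $\Xi_\psi(P)=2^{-n}\langle\psi|P|\psi\rangle^2$ is a probability distribution on the $4^n$ Pauli strings $P\in\{I,X,Y,Z\}^{\otimes n}$ and $S_\alpha$ is the Rényi entropy in bits (the Shannon entropy for $\alpha=1$, the logarithm of the size of the support for $\alpha=0$). The relative entropy of coherence is $C_{\mathrm{rel.ent.}}(\rho)=S(\rho_{\mathrm{diag}})-S(\rho)$, where $S$ is the von Neumann entropy in bits and $\rho_{\mathrm{diag}}$ is $\rho$ with its off-diagonal entries removed. Suppose that $K=2^{\Theta(\log(t/\epsilon))}$.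 Precisely, fix constants $0<c_1\le c_2$; below, $n,t,K$ range over the natural numbers and $\epsilon$ over the reals with $t\ge1$, $0<\epsilon\le 1$, $K\le 2^n$ and $$2^{c_1\log_2(t/\epsilon)}\le K\le 2^{c_2\log_2(t/\epsilon)}.$$ (1) For every constant $\alpha\ge0$, $\mathbb E_{\psi\sim\mathcal E_{\mathrm{rsp}}(n,K)}[M_\alpha(\psi)]=\Theta(\log(t/\epsilon))$. Precisely, there are constants $a,b>0$ and $R$, depending only on $\alpha,c_1,c_2$, such that for all such $n,t,K,\epsilon$ $$\mathbb E_{\psi\sim\mathcal E_{\mathrm{rsp}}(n,K)}[M_\alpha(\psi)]\le b\log_2(t/\epsilon),$$ and, whenever $t/\epsilon\ge R$, $$a\log_2(t/\epsilon)\le \mathbb E_{\psi\sim\mathcal E_{\mathrm{rsp}}(n,K)}[M_\alpha(\psi)].$$ (2) $\mathbb E_{\psi\sim\mathcal E_{\mathrm{rsp}}(n,K)}[C_{\mathrm{rel.ent.}}(|\psi\rangle\langle\psi|)]=\Omega(\log(t/\epsilon))$. Precisely, there is a constant $d>0$, depending only on $c_1,c_2$, such that for all such $n,t,K,\epsilon$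 $$\mathbb E_{\psi\sim\mathcal E_{\mathrm{rsp}}(n,K)}[C_{\mathrm{rel.ent.}}(|\psi\rangle\langle\psi|)]\ge d\,\log_2(t/\epsilon).$$ -/

import Mathlib

open scoped BigOperators Matrix

noncomputable section

/-- Bit strings of length `n`; they label the computational basis of `n` qubits. -/
abbrev BitString (n : ℕ) : Type := Fin n → Fin 2

/-- The amplitudes, in the computational basis, of a vector of the `n`-qubit space. -/
abbrev QubitVector (n : ℕ) : Type := BitString n → ℂ

/-- The four single-qubit Pauli matrices `I, X, Y, Z`. -/
def pauliMatrix : Fin 4 → Matrix (Fin 2) (Fin 2) ℂ :=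
  ![1, !![0, 1; 1, 0], !![0, -Complex.I; Complex.I, 0], !![1, 0; 0, -1]]

/-- The `n`-qubit Pauli operator `P 0 ⊗ ⋯ ⊗ P (n - 1)`. The strings `P` enumerate the `4 ^ n`
elements of the `n`-qubit Pauli group modulo phases. -/
def pauliString {n : ℕ} (P : Fin n → Fin 4) : Matrix (BitString n) (BitString n) ℂ :=
  Matrix.of fun x y => ∏ i, pauliMatrix (P i) (x i) (y i)

/-- The expectation value `⟨ψ|P|ψ⟩`, which is real because `P` is Hermitian. -/
def pauliExpectation {n : ℕ} (ψ : QubitVector n) (P : Fin n → Fin 4) : ℝ :=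
  (star ψ ⬝ᵥ (pauliString P *ᵥ ψ)).re

/-- The Pauli distribution `Ξ_ψ(P) = 2⁻ⁿ ⟨ψ|P|ψ⟩²`. -/
def pauliDistribution {n : ℕ} (ψ : QubitVector n) (P : Fin n → Fin 4) : ℝ :=
  (2 ^ n : ℝ)⁻¹ * pauliExpectation ψ P ^ 2

/-- The Rényi entropy (in bits) of order `α ≥ 0` of a finite distribution: the Shannon entropy for
`α = 1`; for `α = 0` it is the logarithm of the size of the support. -/
def renyiEntropy {ι : Type*} [Fintype ι] (α : ℝ) (p : ι → ℝ) : ℝ :=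
  open Classical in
  if α = 1 then -∑ i, p i * Real.logb 2 (p i)
  else (1 / (1 - α)) * Real.logb 2 (∑ i with p i ≠ 0, p i ^ α)

/-- The stabilizer Rényi entropy `M_α(ψ) = S_α(Ξ_ψ) - log 2ⁿ`. -/
def stabilizerRenyiEntropy {n : ℕ} (α : ℝ) (ψ : QubitVector n) : ℝ :=
  renyiEntropy α (pauliDistribution ψ) - Real.logb 2 (2 ^ n)

/-- The von Neumann entropy (in bits) of a Hermitian matrix, `-∑ λ log λ` over its eigenvalues. -/
def vonNeumannEntropy {ι : Type*} [Fintype ι] [DecidableEq ι] {ρ : Matrix ι ι ℂ}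
    (hρ : ρ.IsHermitian) : ℝ :=
  -∑ i, hρ.eigenvalues i * Real.logb 2 (hρ.eigenvalues i)

theorem isHermitian_diagonal_diag {ι : Type*} [DecidableEq ι] {ρ : Matrix ι ι ℂ}
    (hρ : ρ.IsHermitian) : (Matrix.diagonal ρ.diag).IsHermitian := by
  refine Matrix.isHermitian_diagonal_of_self_adjoint _ ?_
  ext i
  exact hρ.apply i i

/-- The relative entropy of coherence `S(ρ_diag) - S(ρ)`. -/
def relEntropyCoherence {ι : Type*} [Fintype ι] [DecidableEq ι] {ρ : Matrix ι ι ℂ}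
    (hρ : ρ.IsHermitian) : ℝ :=
  vonNeumannEntropy (isHermitian_diagonal_diag hρ) - vonNeumannEntropy hρ

/-- The matrix `|ψ⟩⟨ψ|`. -/
def pureDensity {n : ℕ} (ψ : QubitVector n) : Matrix (BitString n) (BitString n) ℂ :=
  Matrix.vecMulVec ψ (star ψ)

theorem pureDensity_isHermitian {n : ℕ} (ψ : QubitVector n) : (pureDensity ψ).IsHermitian := by
  ext i j
  simp [pureDensity, Matrix.vecMulVec_apply, mul_comm]

/-- The relative entropy of coherence of the pure state `|ψ⟩⟨ψ|`. -/
def pureCoherence {n : ℕ} (ψ : QubitVector n) : ℝ :=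
  relEntropyCoherence (pureDensity_isHermitian ψ)

/-- The subset phase state `|S|^(-1/2) ∑_{x ∈ S} (-1)^(f x) |x⟩`. -/
def subsetPhaseState {n : ℕ} (S : Finset (BitString n)) (f : BitString n → Fin 2) :
    QubitVector n :=
  fun x => if x ∈ S then (-1 : ℂ) ^ (f x : ℕ) / (Real.sqrt (S.card : ℝ) : ℂ) else 0

/-- The expectation of `F ψ` when `ψ` is a random `n`-qubit subset phase state of subset
dimension `K`: the subset `S` is uniform among the subsets of size `K`, and the phase function `f`
is uniform among all Boolean functions, independently of `S`. -/
def rspExpectation (n K : ℕ) (F : QubitVector n → ℝ) : ℝ :=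
  (∑ S ∈ Finset.powersetCard K (Finset.univ : Finset (BitString n)),
      ∑ f : BitString n → Fin 2, F (subsetPhaseState S f)) /
    ((Finset.powersetCard K (Finset.univ : Finset (BitString n))).card *
      Fintype.card (BitString n → Fin 2))

end

/-! ### Characters of the bit strings -/

/-! Every bound is proved for each fixed subset `S` of size `K`; only the phases are averaged, and
the hypothesis makes `log K` comparable to `log (t / ε)`. Up to a phase, a Pauli string is `X ^ a Z
^ b` with bit strings `a`, `b` (addition is bitwise XOR), so for a real state `φ` everything reduces
to Fourier analysis of `x ↦ φ x * φ (x + a)`.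

Upper bound: a Pauli with nonzero expectation has `a ∈ S + S`, so at most `K² 2ⁿ` Paulis contribute
and `M_α ≤ 2 log K` (`stabilizerRenyiEntropy_le`).

Lower bound: `M_α` is at least a positive multiple of `M_2` (`collisionFactor_mul_le`), and `M_2` is
minus the logarithm of the stabilizer purity, a sum over `a, x, y, z` of products of eight
amplitudes. Averaging over the phases kills every term in which the point `x` occurs only once. Each
of the seven possible coincidences leaves at most `K³` terms of size `K⁻⁴`, so the mean purity is at
most `7 / K` (`sum_stabilizerPurity_le`), and Jensen's inequality gives a mean `M_2` of at least
`log K - log 7`.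

Coherence: the diagonal of the state is uniform on `S`, and a pure state has zero entropy, so the
coherence is exactly `log K`. -/

theorem BitString.add_self {n : ℕ} (x : BitString n) : x + x = 0 := by
  funext i
  have h : ∀ u : Fin 2, u + u = 0 := by decide
  exact h (x i)

theorem BitString.add_cancel_right' {n : ℕ} (x y : BitString n) : x + y + y = x := by
  rw [add_assoc, BitString.add_self, add_zero]

theorem BitString.eq_add_iff {n : ℕ} {x y z : BitString n} : x = y + z ↔ y = x + z := by
  constructor
  · rintro rfl; rw [BitString.add_cancel_right']
  · rintro rfl; rw [BitString.add_cancel_right']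

theorem BitString.add_eq_zero_iff {n : ℕ} {x y : BitString n} : x + y = 0 ↔ x = y := by
  rw [eq_comm, BitString.eq_add_iff, zero_add, eq_comm]

/-- The character `(-1) ^ (b ⬝ x)` of the group of bit strings. -/
noncomputable def bitChar {n : ℕ} (b x : BitString n) : ℝ :=
  ∏ i, (-1 : ℝ) ^ ((b i : ℕ) * (x i : ℕ))

theorem bitChar_add {n : ℕ} (b x y : BitString n) :
    bitChar b (x + y) = bitChar b x * bitChar b y := by
  unfold bitChar
  rw [← Finset.prod_mul_distrib]
  refine Finset.prod_congr rfl fun i _ => ?_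
  simp only [Pi.add_apply]
  generalize b i = u; generalize x i = v; generalize y i = w
  fin_cases u <;> fin_cases v <;> fin_cases w <;> simp

/-- Character orthogonality: the sum factors over the bits, and a bit with `x i = 1` contributes `1
+ (-1) = 0`. -/
theorem sum_bitChar {n : ℕ} (x : BitString n) :
    ∑ b, bitChar b x = if x = 0 then (2 : ℝ) ^ n else 0 := by
  have h : ∑ b, bitChar b x = ∏ i, ∑ u : Fin 2, (-1 : ℝ) ^ ((u : ℕ) * (x i : ℕ)) := by
    rw [Finset.prod_univ_sum, Fintype.piFinset_univ]; rfl
  rw [h]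
  split_ifs with hx
  · subst hx; simp
  · obtain ⟨i, hi⟩ := Function.ne_iff.1 hx
    refine Finset.prod_eq_zero (Finset.mem_univ i) ?_
    have : x i = 1 := by
      revert hi; simp only [Pi.zero_apply]; generalize x i = u; revert u; decide
    simp [this]

/-- Parseval's identity. -/
theorem sum_sq_sum_mul_bitChar {n : ℕ} (g : BitString n → ℝ) :
    ∑ b, (∑ x, g x * bitChar b x) ^ 2 = 2 ^ n * ∑ x, g x ^ 2 := by
  have h : ∀ b, (∑ x, g x * bitChar b x) ^ 2 =
      ∑ x, ∑ y, g x * g y * bitChar b (x + y) := fun b => by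
    rw [sq, Finset.sum_mul_sum]
    refine Finset.sum_congr rfl fun x _ => Finset.sum_congr rfl fun y _ => ?_
    rw [bitChar_add]; ring
  simp_rw [h]
  rw [Finset.sum_comm, Finset.mul_sum]
  refine Finset.sum_congr rfl fun x _ => ?_
  rw [Finset.sum_comm]
  simp_rw [← Finset.mul_sum, sum_bitChar, BitString.add_eq_zero_iff]
  simp; ring

/-- Once the fourth power is expanded, orthogonality forces the fourth point to be `x + y + z`. -/
theorem sum_pow_four_sum_mul_bitChar {n : ℕ} (g : BitString n → ℝ) :
    ∑ b, (∑ x, g x * bitChar b x) ^ 4 =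
      2 ^ n * ∑ x, ∑ y, ∑ z, g x * g y * g z * g (x + y + z) := by
  have h : ∀ b, (∑ x, g x * bitChar b x) ^ 4 =
      ∑ x, ∑ y, ∑ z, ∑ w, g x * g y * g z * g w * bitChar b (x + y + z + w) := fun b => by
    rw [pow_succ, pow_succ, sq, Finset.sum_mul_sum, Finset.sum_mul, Finset.sum_mul]
    refine Finset.sum_congr rfl fun x _ => ?_
    rw [Finset.sum_mul, Finset.sum_mul]
    refine Finset.sum_congr rfl fun y _ => ?_
    rw [mul_assoc, Finset.sum_mul_sum, Finset.mul_sum]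
    refine Finset.sum_congr rfl fun z _ => ?_
    rw [Finset.mul_sum]
    refine Finset.sum_congr rfl fun w _ => ?_
    simp_rw [bitChar_add]; ring
  simp_rw [h]
  rw [Finset.sum_comm, Finset.mul_sum]
  refine Finset.sum_congr rfl fun x _ => ?_
  rw [Finset.sum_comm, Finset.mul_sum]
  refine Finset.sum_congr rfl fun y _ => ?_
  rw [Finset.sum_comm, Finset.mul_sum]
  refine Finset.sum_congr rfl fun z _ => ?_
  rw [Finset.sum_comm]
  simp_rw [← Finset.mul_sum, sum_bitChar, BitString.add_eq_zero_iff]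
  simp; ring

/-! ### Pauli expectations of real vectors -/

/-- Single-qubit Pauli matrices are labelled by a bit-flip bit and a phase-flip bit. -/
noncomputable def pauliBits : Fin 4 ≃ Fin 2 × Fin 2 :=
  Equiv.ofBijective (fun p => (![0, 1, 1, 0] p, ![0, 0, 1, 1] p)) (by decide)

/-- Pauli strings are labelled by a bit-flip string and a phase-flip string. -/
noncomputable def pauliStringBits (n : ℕ) : (Fin n → Fin 4) ≃ BitString n × BitString n :=
  (Equiv.arrowCongr (Equiv.refl _) pauliBits).trans (Equiv.arrowProdEquivProdArrow _ _ _)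

/-- The phase relating `Y` to `X * Z`. -/
noncomputable def pauliPhase : Fin 4 → ℂ := ![1, 1, Complex.I, 1]

theorem pauliMatrix_apply (p : Fin 4) (x y : Fin 2) :
    pauliMatrix p x y = pauliPhase p *
      if x = y + (pauliBits p).1 then (-1 : ℂ) ^ (((pauliBits p).2 : ℕ) * (y : ℕ)) else 0 := by
  fin_cases p <;> fin_cases x <;> fin_cases y <;>
    simp [pauliMatrix, pauliPhase, pauliBits]

theorem pauliString_apply {n : ℕ} (P : Fin n → Fin 4) (x y : BitString n) :
    pauliString P x y = (∏ i, pauliPhase (P i)) *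
      if x = y + (pauliStringBits n P).1 then
        ((bitChar (pauliStringBits n P).2 y : ℝ) : ℂ) else 0 := by
  simp only [pauliString, Matrix.of_apply, pauliMatrix_apply, Finset.prod_mul_distrib]
  congr 1
  split_ifs with h
  · unfold bitChar
    push_cast
    refine Finset.prod_congr rfl fun i _ => ?_
    exact if_pos (congrFun h i)
  · obtain ⟨i, hi⟩ := Function.ne_iff.1 h
    exact Finset.prod_eq_zero (Finset.mem_univ i) (if_neg hi)

theorem pauliString_isHermitian {n : ℕ} (P : Fin n → Fin 4) : (pauliString P).IsHermitian := by
  have h : ∀ (p : Fin 4) (x y : Fin 2), star (pauliMatrix p x y) = pauliMatrix p y x := by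
    intro p x y
    fin_cases p <;> fin_cases x <;> fin_cases y <;> simp [pauliMatrix]
  ext x y
  simp only [pauliString, Matrix.conjTranspose_apply, Matrix.of_apply, star_prod, h]

theorem norm_prod_pauliPhase {n : ℕ} (P : Fin n → Fin 4) : ‖∏ i, pauliPhase (P i)‖ = 1 := by
  have h : ∀ p, ‖pauliPhase p‖ = 1 := by
    intro p; fin_cases p <;> simp [pauliPhase]
  simp [norm_prod, h]

/-- The autocorrelation `⟨φ| X ^ a Z ^ b |φ⟩` of a real vector. -/
noncomputable def bitCorrelation {n : ℕ} (φ : BitString n → ℝ) (a b : BitString n) : ℝ :=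
  ∑ x, φ x * φ (x + a) * bitChar b x

theorem pauliExpectation_sq {n : ℕ} (φ : BitString n → ℝ) (P : Fin n → Fin 4) :
    pauliExpectation (fun x => (φ x : ℂ)) P ^ 2 =
      bitCorrelation φ (pauliStringBits n P).1 (pauliStringBits n P).2 ^ 2 := by
  set ψ : QubitVector n := fun x => (φ x : ℂ) with hψ
  have hz : star ψ ⬝ᵥ (pauliString P *ᵥ ψ) = (∏ i, pauliPhase (P i)) *
      ((bitCorrelation φ (pauliStringBits n P).1 (pauliStringBits n P).2 : ℝ) : ℂ) := by
    simp only [dotProduct, Matrix.mulVec, pauliString_apply, Finset.mul_sum]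
    rw [Finset.sum_comm]
    simp only [bitCorrelation, Complex.ofReal_sum, Finset.mul_sum]
    refine Finset.sum_congr rfl fun y _ => ?_
    rw [Finset.sum_eq_single (y + (pauliStringBits n P).1)]
    · simp [hψ]; ring
    · intro x _ hx; simp [hx]
    · simp
  -- A real number squared is its squared modulus, so the unit phase in `hz` drops out.
  have him : (star ψ ⬝ᵥ (pauliString P *ᵥ ψ)).im = 0 :=
    (pauliString_isHermitian P).im_star_dotProduct_mulVec_self ψ
  have hn := congrArg (fun z : ℂ => ‖z‖ ^ 2) hz
  simp only [norm_mul, norm_prod_pauliPhase, one_mul, Complex.norm_real, Real.norm_eq_abs,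
    sq_abs] at hn
  rw [← hn, Complex.sq_norm, Complex.normSq_apply, him, pauliExpectation]
  ring

theorem sum_pauliStringBits {n : ℕ} (F : BitString n → BitString n → ℝ) :
    ∑ P, F (pauliStringBits n P).1 (pauliStringBits n P).2 = ∑ a, ∑ b, F a b := by
  rw [← Fintype.sum_prod_type', ← Equiv.sum_comp (pauliStringBits n)]

/-- Parseval in `b` for each `a`; the substitution `a ↦ x + a` then decouples the two factors. This
gives the Pauli distribution total mass one. -/
theorem sum_bitCorrelation_sq {n : ℕ} (φ : BitString n → ℝ) :
    ∑ a, ∑ b, bitCorrelation φ a b ^ 2 = 2 ^ n * (∑ x, φ x ^ 2) ^ 2 := by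
  simp_rw [bitCorrelation, sum_sq_sum_mul_bitChar]
  rw [← Finset.mul_sum, Finset.sum_comm, sq (∑ x, φ x ^ 2), Finset.sum_mul]
  congr 1
  refine Finset.sum_congr rfl fun x _ => ?_
  rw [Finset.mul_sum, ← Equiv.sum_comp (Equiv.addLeft x)]
  simp [mul_pow, ← add_assoc, BitString.add_self]

theorem sum_bitCorrelation_pow_four {n : ℕ} (φ : BitString n → ℝ) :
    ∑ a, ∑ b, bitCorrelation φ a b ^ 4 = 2 ^ n * ∑ a, ∑ x, ∑ y, ∑ z,
      (φ x * φ (x + a)) * (φ y * φ (y + a)) * (φ z * φ (z + a)) *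
        (φ (x + y + z) * φ (x + y + z + a)) := by
  simp_rw [bitCorrelation, sum_pow_four_sum_mul_bitChar]
  rw [← Finset.mul_sum]

/-! ### Rényi entropies -/

section Renyi

variable {ι : Type*}

theorem sum_mul_logb_le_logb_sum {s : Finset ι} {p u : ι → ℝ} (hp : ∀ i ∈ s, 0 < p i)
    (hsum : ∑ i ∈ s, p i = 1) (hu : ∀ i ∈ s, 0 < u i) :
    ∑ i ∈ s, p i * Real.logb 2 (u i) ≤ Real.logb 2 (∑ i ∈ s, p i * u i) := by
  have h := strictConcaveOn_log_Ioi.concaveOn.le_map_sum (t := s) (w := p) (p := u)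
    (fun i hi => (hp i hi).le) hsum (fun i hi => hu i hi)
  simp only [smul_eq_mul] at h
  have h2 : 0 < Real.log 2 := Real.log_pos (by norm_num)
  simp only [Real.logb, ← mul_div_assoc, ← Finset.sum_div]
  gcongr

theorem sum_mul_rpow_le_rpow_sum {s : Finset ι} {p u : ι → ℝ} (hp : ∀ i ∈ s, 0 < p i)
    (hsum : ∑ i ∈ s, p i = 1) (hu : ∀ i ∈ s, 0 < u i) {r : ℝ} (hr : 0 ≤ r) (hr1 : r ≤ 1) :
    ∑ i ∈ s, p i * u i ^ r ≤ (∑ i ∈ s, p i * u i) ^ r := by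
  have h := (Real.concaveOn_rpow hr hr1).le_map_sum (t := s) (w := p) (p := u)
    (fun i hi => (hp i hi).le) hsum (fun i hi => (hu i hi).le)
  simpa only [smul_eq_mul] using h

variable [Fintype ι]

open Classical in
theorem renyiEntropy_one (p : ι → ℝ) :
    renyiEntropy 1 p = -∑ i with p i ≠ 0, p i * Real.logb 2 (p i) := by
  rw [renyiEntropy, if_pos rfl, Finset.sum_filter]
  congr 1
  refine Finset.sum_congr rfl fun i _ => ?_
  split_ifs with h
  · rfl
  · push Not at h; simp [h]

open Classical in
theorem renyiEntropy_two (p : ι → ℝ) :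
    renyiEntropy 2 p = -Real.logb 2 (∑ i, p i ^ 2) := by
  rw [renyiEntropy, if_neg (by norm_num), Finset.sum_filter]
  norm_num
  congr 1
  refine Finset.sum_congr rfl fun i _ => ?_
  split_ifs with h <;> simp [h]

variable {p : ι → ℝ}

open Classical in
theorem sum_support_eq_one (hsum : ∑ i, p i = 1) : ∑ i with p i ≠ 0, p i = 1 := by
  rw [Finset.sum_filter_ne_zero, hsum]

open Classical in
theorem pos_of_mem_support (hp : ∀ i, 0 ≤ p i) :
    ∀ i ∈ Finset.univ.filter (fun i => p i ≠ 0), 0 < p i := fun i hi =>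
  lt_of_le_of_ne (hp i) (Finset.mem_filter.1 hi).2.symm

open Classical in
theorem sum_rpow_pos (hp : ∀ i, 0 ≤ p i) (hsum : ∑ i, p i = 1) (α : ℝ) :
    0 < ∑ i with p i ≠ 0, p i ^ α := by
  refine Finset.sum_pos (fun i hi => Real.rpow_pos_of_pos (pos_of_mem_support hp i hi) _) ?_
  by_contra h
  rw [Finset.not_nonempty_iff_eq_empty] at h
  have := sum_support_eq_one hsum
  rw [h] at this
  simp at this

open Classical in
theorem sum_mul_rpow_sub_one (hp : ∀ i, 0 ≤ p i) (α : ℝ) :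
    ∑ i with p i ≠ 0, p i * p i ^ (α - 1) = ∑ i with p i ≠ 0, p i ^ α := by
  refine Finset.sum_congr rfl fun i hi => ?_
  have h := pos_of_mem_support hp i hi
  rw [Real.rpow_sub_one h.ne', mul_div_cancel₀ _ h.ne']

open Classical in
-- Jensen for the logarithm, with `p ^ α = p * p ^ (α - 1)`. Dividing by `1 - α` compares order `α`
-- with Shannon entropy, in opposite directions for `α < 1` and `α > 1`.
theorem logb_sum_rpow_ge (hp : ∀ i, 0 ≤ p i) (hsum : ∑ i, p i = 1) (α : ℝ) :
    (1 - α) * renyiEntropy 1 p ≤ Real.logb 2 (∑ i with p i ≠ 0, p i ^ α) := by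
  have hpos := pos_of_mem_support hp
  have h := sum_mul_logb_le_logb_sum hpos (sum_support_eq_one hsum)
    (u := fun i => p i ^ (α - 1)) (fun i hi => Real.rpow_pos_of_pos (hpos i hi) _)
  rw [sum_mul_rpow_sub_one hp] at h
  refine le_trans (le_of_eq ?_) h
  rw [renyiEntropy_one, mul_neg, ← neg_mul, Finset.mul_sum]
  refine Finset.sum_congr rfl fun i hi => ?_
  rw [Real.logb_rpow_eq_mul_logb_of_pos (hpos i hi)]
  ring

open Classical in
theorem renyiEntropy_one_le (hp : ∀ i, 0 ≤ p i) (hsum : ∑ i, p i = 1) :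
    renyiEntropy 1 p ≤ Real.logb 2 (Finset.univ.filter fun i => p i ≠ 0).card := by
  have hpos := pos_of_mem_support hp
  have h := sum_mul_logb_le_logb_sum hpos (sum_support_eq_one hsum)
    (u := fun i => (p i)⁻¹) (fun i hi => inv_pos.2 (hpos i hi))
  have e : ∑ i with p i ≠ 0, p i * (p i)⁻¹ = (Finset.univ.filter fun i => p i ≠ 0).card := by
    rw [Finset.card_eq_sum_ones, Nat.cast_sum]
    refine Finset.sum_congr rfl fun i hi => ?_
    rw [mul_inv_cancel₀ (hpos i hi).ne', Nat.cast_one]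
  rw [e] at h
  refine le_trans (le_of_eq ?_) h
  rw [renyiEntropy_one, ← Finset.sum_neg_distrib]
  refine Finset.sum_congr rfl fun i _ => ?_
  rw [Real.logb_inv]; ring

open Classical in
/-- Every Rényi entropy is at most the logarithm of the size of the support. -/
theorem renyiEntropy_le (hp : ∀ i, 0 ≤ p i) (hsum : ∑ i, p i = 1) {α : ℝ} (hα : 0 ≤ α) :
    renyiEntropy α p ≤ Real.logb 2 (Finset.univ.filter fun i => p i ≠ 0).card := by
  have hpos := pos_of_mem_support hp
  rcases lt_trichotomy α 1 with h | rfl | h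
  · rw [renyiEntropy, if_neg h.ne]
    -- For `α < 1`, concavity of the power `1 - α` is applied to `1 / p`, whose mean is the size of
    -- the support.
    have hc := sum_mul_rpow_le_rpow_sum hpos (sum_support_eq_one hsum)
      (u := fun i => (p i)⁻¹) (fun i hi => inv_pos.2 (hpos i hi)) (r := 1 - α)
      (by linarith) (by linarith)
    have e : ∑ i with p i ≠ 0, p i * (p i)⁻¹ = (Finset.univ.filter fun i => p i ≠ 0).card := by
      rw [Finset.card_eq_sum_ones, Nat.cast_sum]
      refine Finset.sum_congr rfl fun i hi => ?_
      rw [mul_inv_cancel₀ (hpos i hi).ne', Nat.cast_one]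
    have e' : ∑ i with p i ≠ 0, p i * (p i)⁻¹ ^ (1 - α) = ∑ i with p i ≠ 0, p i ^ α := by
      rw [← sum_mul_rpow_sub_one hp]
      refine Finset.sum_congr rfl fun i hi => ?_
      rw [Real.inv_rpow (hp i), ← Real.rpow_neg (hp i), neg_sub]
    rw [e, e'] at hc
    have hl := Real.logb_le_logb_of_le (b := 2) (by norm_num) (sum_rpow_pos hp hsum α) hc
    have hcard : (0 : ℝ) < (Finset.univ.filter fun i => p i ≠ 0).card := by
      have := sum_rpow_pos hp hsum 0
      simpa using this
    rw [Real.logb_rpow_eq_mul_logb_of_pos hcard] at hl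
    rw [one_div, inv_mul_le_iff₀ (by linarith)]
    exact hl
  · exact renyiEntropy_one_le hp hsum
  · refine le_trans ?_ (renyiEntropy_one_le hp hsum)
    have := logb_sum_rpow_ge hp hsum α
    rw [renyiEntropy, if_neg h.ne']
    have h1 : (1 / (1 - α)) < 0 := one_div_neg.2 (by linarith)
    have h2 := mul_le_mul_of_nonpos_left this h1.le
    rwa [← mul_assoc, one_div_mul_cancel (by linarith), one_mul] at h2

open Classical in
theorem renyiEntropy_two_le_one (hp : ∀ i, 0 ≤ p i) (hsum : ∑ i, p i = 1) :
    renyiEntropy 2 p ≤ renyiEntropy 1 p := by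
  have := logb_sum_rpow_ge hp hsum 2
  rw [renyiEntropy, if_neg (by norm_num)]
  linarith

open Classical in
/-- The Rényi entropy of order at most `2` is at least the collision entropy. -/
theorem renyiEntropy_two_le (hp : ∀ i, 0 ≤ p i) (hsum : ∑ i, p i = 1) {α : ℝ} (hα : α ≤ 2) :
    renyiEntropy 2 p ≤ renyiEntropy α p := by
  have hpos := pos_of_mem_support hp
  rcases lt_trichotomy α 1 with h | rfl | h
  · refine (renyiEntropy_two_le_one hp hsum).trans ?_
    have := logb_sum_rpow_ge hp hsum α
    rw [renyiEntropy.eq_1 α, if_neg h.ne]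
    rw [one_div, le_inv_mul_iff₀ (by linarith)]
    exact this
  · exact renyiEntropy_two_le_one hp hsum
  -- For `1 < α ≤ 2` the power `α - 1` is concave, so `∑ p ^ α ≤ (∑ p ^ 2) ^ (α - 1)`.
  · have hc := sum_mul_rpow_le_rpow_sum hpos (sum_support_eq_one hsum) hpos (r := α - 1)
      (by linarith) (by linarith)
    rw [sum_mul_rpow_sub_one hp] at hc
    have hl := Real.logb_le_logb_of_le (b := 2) (by norm_num) (sum_rpow_pos hp hsum α) hc
    have e : ∑ i with p i ≠ 0, p i * p i = ∑ i with p i ≠ 0, p i ^ (2 : ℝ) := by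
      refine Finset.sum_congr rfl fun i _ => ?_
      rw [Real.rpow_two, sq]
    rw [e, Real.logb_rpow_eq_mul_logb_of_pos (sum_rpow_pos hp hsum 2)] at hl
    rw [renyiEntropy, if_neg (by norm_num), renyiEntropy, if_neg h.ne']
    have : (1 / (1 - α)) = -(α - 1)⁻¹ := by
      rw [one_div, ← neg_sub α 1, inv_neg]
    rw [this]
    have h2 := (inv_mul_le_iff₀ (by linarith : (0:ℝ) < α - 1)).2 hl
    rw [show (1 / (1 - 2) : ℝ) = -1 by norm_num]
    linarith

end Renyi

/-! ### Vectors of unit norm with small support -/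

section StabilizerEntropy

variable {n : ℕ}

theorem pauliDistribution_eq (φ : BitString n → ℝ) (P : Fin n → Fin 4) :
    pauliDistribution (fun x => (φ x : ℂ)) P = (2 ^ n : ℝ)⁻¹ *
      bitCorrelation φ (pauliStringBits n P).1 (pauliStringBits n P).2 ^ 2 := by
  rw [pauliDistribution, pauliExpectation_sq]

theorem pauliDistribution_nonneg (ψ : QubitVector n) (P : Fin n → Fin 4) :
    0 ≤ pauliDistribution ψ P := by
  unfold pauliDistribution; positivity

theorem sum_pauliDistribution {φ : BitString n → ℝ} (hφ : ∑ x, φ x ^ 2 = 1) :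
    ∑ P, pauliDistribution (fun x => (φ x : ℂ)) P = 1 := by
  simp_rw [pauliDistribution_eq]
  rw [sum_pauliStringBits fun a b => (2 ^ n : ℝ)⁻¹ * bitCorrelation φ a b ^ 2]
  simp_rw [← Finset.mul_sum]
  rw [sum_bitCorrelation_sq, hφ]
  simp

/-- The stabilizer purity `2⁻ⁿ ∑_P ⟨φ|P|φ⟩⁴` of a real vector. -/
noncomputable def stabilizerPurity (φ : BitString n → ℝ) : ℝ :=
  ∑ a, ∑ x, ∑ y, ∑ z, (φ x * φ (x + a)) * (φ y * φ (y + a)) * (φ z * φ (z + a)) *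
        (φ (x + y + z) * φ (x + y + z + a))

theorem sum_pauliDistribution_sq (φ : BitString n → ℝ) :
    ∑ P, pauliDistribution (fun x => (φ x : ℂ)) P ^ 2 = (2 ^ n : ℝ)⁻¹ * stabilizerPurity φ := by
  simp_rw [pauliDistribution_eq, mul_pow, ← pow_mul]
  rw [sum_pauliStringBits fun a b => (2 ^ n : ℝ)⁻¹ ^ 2 * bitCorrelation φ a b ^ (2 * 2)]
  simp_rw [← Finset.mul_sum]
  rw [sum_bitCorrelation_pow_four, stabilizerPurity]
  field_simp

theorem stabilizerPurity_pos {φ : BitString n → ℝ} (hφ : ∑ x, φ x ^ 2 = 1) :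
    0 < stabilizerPurity φ := by
  have h : 0 < ∑ P, pauliDistribution (fun x => (φ x : ℂ)) P ^ 2 := by
    refine lt_of_le_of_ne (Finset.sum_nonneg fun P _ => sq_nonneg _) fun h0 => ?_
    have h1 := sum_pauliDistribution hφ
    rw [Finset.sum_eq_zero fun P hP => pow_eq_zero_iff two_ne_zero |>.1
      ((Finset.sum_eq_zero_iff_of_nonneg fun P _ => sq_nonneg _).1 h0.symm P hP)] at h1
    exact zero_ne_one h1
  rw [sum_pauliDistribution_sq] at h
  exact pos_of_mul_pos_right h (by positivity)

theorem stabilizerRenyiEntropy_two {φ : BitString n → ℝ} (hφ : ∑ x, φ x ^ 2 = 1) :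
    stabilizerRenyiEntropy 2 (fun x => (φ x : ℂ)) = -Real.logb 2 (stabilizerPurity φ) := by
  rw [stabilizerRenyiEntropy, renyiEntropy_two, sum_pauliDistribution_sq,
    Real.logb_mul (by positivity) (stabilizerPurity_pos hφ).ne', Real.logb_inv]
  ring

/-- The constant comparing the stabilizer Rényi entropy of order `α` with that of order `2`. -/
noncomputable def collisionFactor (α : ℝ) : ℝ := if α ≤ 2 then 1 else (α - 1)⁻¹

theorem collisionFactor_pos (α : ℝ) : 0 < collisionFactor α := by
  unfold collisionFactor
  split_ifs with h
  · exact one_pos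
  · exact inv_pos.2 (by linarith)

open Classical in
-- Monotonicity settles `α ≤ 2`. For `α > 2`, every probability is at most `2⁻ⁿ`, so `p ^ α ≤ (2⁻ⁿ)
-- ^ (α - 2) * p ^ 2`; the powers of `2ⁿ` cancel against the normalisation of `M_α`, leaving the
-- factor `1 / (α - 1)`.
theorem collisionFactor_mul_le {φ : BitString n → ℝ} (hφ : ∑ x, φ x ^ 2 = 1)
    (hq : ∀ a b, bitCorrelation φ a b ^ 2 ≤ 1) (α : ℝ) :
    collisionFactor α * stabilizerRenyiEntropy 2 (fun x => (φ x : ℂ)) ≤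
      stabilizerRenyiEntropy α (fun x => (φ x : ℂ)) := by
  have hp := pauliDistribution_nonneg (fun x => (φ x : ℂ))
  have hs := sum_pauliDistribution hφ
  unfold collisionFactor
  split_ifs with h
  · rw [one_mul]
    exact sub_le_sub_right (renyiEntropy_two_le hp hs h) _
  · push Not at h
    rw [inv_mul_le_iff₀ (by linarith), stabilizerRenyiEntropy_two hφ, stabilizerRenyiEntropy,
      renyiEntropy, if_neg (by linarith)]
    set p := pauliDistribution (fun x => (φ x : ℂ)) with hpdef
    have hle : ∑ P with p P ≠ 0, p P ^ α ≤
        ((2 : ℝ) ^ n) ^ (-(α - 1)) * stabilizerPurity φ := by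
      have h2 : ((2 : ℝ) ^ n) ^ (-(α - 1)) * stabilizerPurity φ =
          ((2 : ℝ) ^ n) ^ (-(α - 2)) * ∑ P, p P ^ 2 := by
        rw [sum_pauliDistribution_sq, ← mul_assoc, ← Real.rpow_neg_one, ← Real.rpow_add
          (by positivity)]
        ring_nf
      rw [h2, Finset.mul_sum]
      refine (Finset.sum_le_sum fun P hP => ?_).trans
        (Finset.sum_le_sum_of_subset_of_nonneg (Finset.filter_subset _ _)
          fun P _ _ => by positivity)
      have hpos := pos_of_mem_support hp P hP
      have hle1 : p P ≤ (2 ^ n : ℝ)⁻¹ := by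
        rw [hpdef, pauliDistribution_eq]
        exact mul_le_of_le_one_right (by positivity) (hq _ _)
      calc p P ^ α = p P ^ (α - 2) * p P ^ 2 := by
            rw [← Real.rpow_two, ← Real.rpow_add hpos]; ring_nf
        _ ≤ ((2 ^ n : ℝ)⁻¹) ^ (α - 2) * p P ^ 2 := by
            gcongr
        _ = _ := by rw [Real.inv_rpow (by positivity), Real.rpow_neg (by positivity)]
    have hl := Real.logb_le_logb_of_le (b := 2) (by norm_num) (sum_rpow_pos hp hs α) hle
    rw [Real.logb_mul (by positivity) (stabilizerPurity_pos hφ).ne',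
      Real.logb_rpow_eq_mul_logb_of_pos (by positivity)] at hl
    have e : (α - 1) * (1 / (1 - α)) = -1 := by
      have : 1 - α ≠ 0 := by linarith
      field_simp
      ring
    rw [mul_sub, ← mul_assoc, e]
    linarith

theorem abs_bitChar (b x : BitString n) : |bitChar b x| = 1 := by
  simp [bitChar, Finset.abs_prod, abs_pow]

/-- Cauchy–Schwarz, since shifts and signs preserve the norm. -/
theorem bitCorrelation_sq_le_one {φ : BitString n → ℝ} (hφ : ∑ x, φ x ^ 2 = 1)
    (a b : BitString n) : bitCorrelation φ a b ^ 2 ≤ 1 := by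
  have h := Finset.sum_mul_sq_le_sq_mul_sq Finset.univ φ (fun x => φ (x + a) * bitChar b x)
  have h1 : ∑ x, (φ (x + a) * bitChar b x) ^ 2 = 1 := by
    simp_rw [mul_pow, ← sq_abs (bitChar b _), abs_bitChar, one_pow, mul_one]
    rw [← hφ]
    exact Equiv.sum_comp (Equiv.addRight a) (fun x => φ x ^ 2)
  rw [hφ, h1, one_mul] at h
  simpa only [bitCorrelation, mul_assoc] using h

open Classical in
-- A nonzero correlation needs some `x` with both `x` and `x + a` in `S`, so `a ∈ S + S`, while `b`
-- is unrestricted.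
theorem card_support_pauliDistribution_le {φ : BitString n → ℝ} {S : Finset (BitString n)}
    (hS : ∀ x, x ∉ S → φ x = 0) :
    (Finset.univ.filter fun P => pauliDistribution (fun x => (φ x : ℂ)) P ≠ 0).card ≤
      S.card * S.card * 2 ^ n := by
  have hsub : (Finset.univ.filter fun P => pauliDistribution (fun x => (φ x : ℂ)) P ≠ 0).map
      (pauliStringBits n).toEmbedding ⊆
      ((S ×ˢ S).image fun q => q.1 + q.2) ×ˢ (Finset.univ : Finset (BitString n)) := by
    intro ab hab
    simp only [Finset.mem_map, Finset.mem_filter, Finset.mem_univ, true_and] at hab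
    obtain ⟨P, hP, rfl⟩ := hab
    rw [pauliDistribution_eq] at hP
    have h0 : bitCorrelation φ (pauliStringBits n P).1 (pauliStringBits n P).2 ≠ 0 := by
      intro h; exact hP (by rw [h]; simp)
    obtain ⟨x, -, hx⟩ := Finset.exists_ne_zero_of_sum_ne_zero h0
    have hx1 := left_ne_zero_of_mul hx
    simp only [Finset.mem_product, Finset.mem_image, Finset.mem_univ, and_true,
      Equiv.coe_toEmbedding]
    refine ⟨(x, x + (pauliStringBits n P).1), ⟨?_, ?_⟩, ?_⟩
    · by_contra h; exact left_ne_zero_of_mul hx1 (hS _ h)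
    · by_contra h; exact right_ne_zero_of_mul hx1 (hS _ h)
    · simp only
      rw [← add_assoc, BitString.add_self, zero_add]
  have hc := Finset.card_le_card hsub
  rw [Finset.card_map, Finset.card_product] at hc
  refine hc.trans (Nat.mul_le_mul ?_ ?_)
  · exact Finset.card_image_le.trans (Finset.card_product S S).le
  · simp

theorem stabilizerRenyiEntropy_le {φ : BitString n → ℝ} (hφ : ∑ x, φ x ^ 2 = 1)
    {S : Finset (BitString n)} (hS : ∀ x, x ∉ S → φ x = 0) {α : ℝ} (hα : 0 ≤ α) :
    stabilizerRenyiEntropy α (fun x => (φ x : ℂ)) ≤ 2 * Real.logb 2 S.card := by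
  classical
  have hp := pauliDistribution_nonneg (fun x => (φ x : ℂ))
  have hs := sum_pauliDistribution hφ
  have h := renyiEntropy_le hp hs hα
  have hpos := sum_rpow_pos hp hs 0
  simp only [Real.rpow_zero, Finset.sum_const, nsmul_eq_mul, mul_one] at hpos
  have hc := card_support_pauliDistribution_le hS
  have hSpos : (0 : ℝ) < S.card := by
    rcases Nat.eq_zero_or_pos S.card with h0 | h0
    · rw [h0] at hc
      simp only [zero_mul, Nat.le_zero] at hc
      rw [hc] at hpos
      simp at hpos
    · exact_mod_cast h0
  have hl := Real.logb_le_logb_of_le (b := 2) (by norm_num) hpos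
    (show _ ≤ ((S.card * S.card * 2 ^ n : ℕ) : ℝ) by exact_mod_cast hc)
  push_cast at hl
  rw [Real.logb_mul (by positivity) (by positivity), Real.logb_mul hSpos.ne' hSpos.ne'] at hl
  rw [stabilizerRenyiEntropy]
  linarith

end StabilizerEntropy

/-! ### The coherence of a pure state -/

/-- The eigenvalues of an idempotent are 0 or 1, and both contribute nothing. -/
theorem vonNeumannEntropy_eq_zero_of_sq {ι : Type*} [Fintype ι] [DecidableEq ι]
    {ρ : Matrix ι ι ℂ} (hρ : ρ.IsHermitian) (h : ρ * ρ = ρ) : vonNeumannEntropy hρ = 0 := by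
  rw [vonNeumannEntropy, neg_eq_zero]
  refine Finset.sum_eq_zero fun i _ => ?_
  have hv := hρ.mulVec_eigenvectorBasis i
  have h2 : ρ *ᵥ (ρ *ᵥ ⇑(hρ.eigenvectorBasis i)) = ρ *ᵥ ⇑(hρ.eigenvectorBasis i) := by
    rw [Matrix.mulVec_mulVec, h]
  rw [hv, Matrix.mulVec_smul, hv, smul_smul] at h2
  have hne : (⇑(hρ.eigenvectorBasis i) : ι → ℂ) ≠ 0 := by
    intro h0
    apply hρ.eigenvectorBasis.orthonormal.ne_zero i
    ext j
    exact congrFun h0 j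
  have h3 := smul_left_injective ℝ hne h2
  have h4 : hρ.eigenvalues i * (hρ.eigenvalues i - 1) = 0 := by
    rw [mul_sub, mul_one]; exact sub_eq_zero.2 h3
  rcases mul_eq_zero.1 h4 with h5 | h5
  · simp [h5]
  · simp [sub_eq_zero.1 h5]

/-- Eigenvalues and diagonal entries agree as multisets, both being the roots of the characteristic
polynomial; no matching of indices is needed. -/
theorem vonNeumannEntropy_diagonal {ι : Type*} [Fintype ι] [DecidableEq ι] {d : ι → ℝ}
    {ρ : Matrix ι ι ℂ} (hd : ρ = Matrix.diagonal fun i => (d i : ℂ)) (hρ : ρ.IsHermitian) :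
    vonNeumannEntropy hρ = -∑ i, d i * Real.logb 2 (d i) := by
  have h1 := hρ.roots_charpoly_eq_eigenvalues
  have h2 : ρ.charpoly.roots = Multiset.map (fun i => (d i : ℂ)) Finset.univ.val := by
    rw [hd, Matrix.charpoly_diagonal]
    have h := Polynomial.roots_multiset_prod_X_sub_C (Finset.univ.val.map fun i => (d i : ℂ))
    rwa [Multiset.map_map] at h
  have h3 := congrArg (Multiset.map fun z : ℂ => z.re * Real.logb 2 z.re) (h1.symm.trans h2)
  simp only [Multiset.map_map] at h3
  rw [vonNeumannEntropy]
  exact congrArg (fun m => -Multiset.sum m) h3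

theorem pureCoherence_eq {n : ℕ} {φ : BitString n → ℝ} (hφ : ∑ x, φ x ^ 2 = 1) :
    pureCoherence (fun x => (φ x : ℂ)) = -∑ x, φ x ^ 2 * Real.logb 2 (φ x ^ 2) := by
  have hsq : pureDensity (fun x => (φ x : ℂ)) * pureDensity (fun x => (φ x : ℂ)) =
      pureDensity (fun x => (φ x : ℂ)) := by
    have h : (star fun x => (φ x : ℂ)) ⬝ᵥ (fun x => (φ x : ℂ)) = 1 := by
      have : ((∑ x, φ x ^ 2 : ℝ) : ℂ) = 1 := by rw [hφ]; simp
      rw [← this]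
      simp [dotProduct, sq]
    rw [pureDensity, Matrix.vecMulVec_mul_vecMulVec, h, one_smul]
  rw [pureCoherence, relEntropyCoherence, vonNeumannEntropy_eq_zero_of_sq _ hsq, sub_zero]
  refine vonNeumannEntropy_diagonal ?_ _
  congr 1
  funext x
  simp [pureDensity, Matrix.vecMulVec_apply, sq]

/-! ### Random phases -/

section RandomPhase

variable {n : ℕ}

/-- The real amplitudes of the subset phase state. -/
noncomputable def subsetPhaseAmplitude (S : Finset (BitString n)) (f : BitString n → Fin 2)
    (x : BitString n) : ℝ :=
  if x ∈ S then (-1 : ℝ) ^ (f x : ℕ) / Real.sqrt (S.card : ℝ) else 0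

theorem subsetPhaseState_eq (S : Finset (BitString n)) (f : BitString n → Fin 2) :
    subsetPhaseState S f = fun x => (subsetPhaseAmplitude S f x : ℂ) := by
  funext x
  simp only [subsetPhaseState, subsetPhaseAmplitude]
  split_ifs <;> simp

theorem subsetPhaseAmplitude_of_notMem {S : Finset (BitString n)} (f : BitString n → Fin 2)
    (x : BitString n) (hx : x ∉ S) : subsetPhaseAmplitude S f x = 0 := if_neg hx

theorem subsetPhaseAmplitude_sq (S : Finset (BitString n)) (f : BitString n → Fin 2)
    (x : BitString n) :
    subsetPhaseAmplitude S f x ^ 2 = if x ∈ S then (S.card : ℝ)⁻¹ else 0 := by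
  unfold subsetPhaseAmplitude
  split_ifs
  · rw [div_pow, ← pow_mul, mul_comm, pow_mul, Real.sq_sqrt (Nat.cast_nonneg _)]
    simp
  · simp

theorem sum_subsetPhaseAmplitude_sq {S : Finset (BitString n)} (hS : S.Nonempty)
    (f : BitString n → Fin 2) : ∑ x, subsetPhaseAmplitude S f x ^ 2 = 1 := by
  have : (S.card : ℝ) ≠ 0 := by exact_mod_cast hS.card_pos.ne'
  simp_rw [subsetPhaseAmplitude_sq]
  simp [this]

theorem pureCoherence_subsetPhaseState {S : Finset (BitString n)} (hS : S.Nonempty)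
    (f : BitString n → Fin 2) :
    pureCoherence (subsetPhaseState S f) = Real.logb 2 S.card := by
  have : (S.card : ℝ) ≠ 0 := by exact_mod_cast hS.card_pos.ne'
  rw [subsetPhaseState_eq, pureCoherence_eq (sum_subsetPhaseAmplitude_sq hS f)]
  have h : ∀ x, subsetPhaseAmplitude S f x ^ 2 * Real.logb 2 (subsetPhaseAmplitude S f x ^ 2) =
      if x ∈ S then (S.card : ℝ)⁻¹ * -Real.logb 2 S.card else 0 := fun x => by
    rw [subsetPhaseAmplitude_sq]
    split_ifs <;> simp [Real.logb_inv]
  simp [h, this]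

theorem subsetPhaseAmplitude_add_single (S : Finset (BitString n)) (f : BitString n → Fin 2)
    (x w : BitString n) :
    subsetPhaseAmplitude S (f + Pi.single x 1) w =
      if w = x then -subsetPhaseAmplitude S f w else subsetPhaseAmplitude S f w := by
  unfold subsetPhaseAmplitude
  by_cases hw : w = x
  · subst hw
    have h : ∀ u : Fin 2, (-1 : ℝ) ^ ((u + 1 : Fin 2) : ℕ) = -(-1) ^ (u : ℕ) := by
      intro u; fin_cases u <;> simp
    simp only [Pi.add_apply, Pi.single_eq_same, h, if_true]
    split_ifs <;> ring
  · simp [hw]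

/-- The indicator function of a set of bit strings. -/
noncomputable def bitIndicator (S : Finset (BitString n)) (x : BitString n) : ℝ :=
  if x ∈ S then 1 else 0

theorem bitIndicator_nonneg (S : Finset (BitString n)) (x : BitString n) :
    0 ≤ bitIndicator S x := by
  unfold bitIndicator; split_ifs <;> norm_num

theorem bitIndicator_le_one (S : Finset (BitString n)) (x : BitString n) :
    bitIndicator S x ≤ 1 := by
  unfold bitIndicator; split_ifs <;> norm_num

theorem sum_bitIndicator (S : Finset (BitString n)) : ∑ x, bitIndicator S x = S.card := by
  simp [bitIndicator]

theorem abs_subsetPhaseAmplitude (S : Finset (BitString n)) (f : BitString n → Fin 2)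
    (x : BitString n) :
    |subsetPhaseAmplitude S f x| = bitIndicator S x * (Real.sqrt (S.card : ℝ))⁻¹ := by
  unfold subsetPhaseAmplitude bitIndicator
  split_ifs
  · simp [abs_div, abs_pow, abs_of_nonneg (Real.sqrt_nonneg _)]
  · simp

/-- The summand of the stabilizer purity. -/
noncomputable def purityTerm (φ : BitString n → ℝ) (a x y z : BitString n) : ℝ :=
  (φ x * φ (x + a)) * (φ y * φ (y + a)) * (φ z * φ (z + a)) *
        (φ (x + y + z) * φ (x + y + z + a))

/-- Eight amplitudes of modulus `K ^ (-1/2)` give `K⁻⁴`. Four of the eight indicators are bounded by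
1; those kept are enough to count the terms. -/
theorem abs_purityTerm_le (S : Finset (BitString n)) (f : BitString n → Fin 2)
    (a x y z : BitString n) :
    |purityTerm (subsetPhaseAmplitude S f) a x y z| ≤ ((S.card : ℝ) ^ 4)⁻¹ *
      (bitIndicator S x * bitIndicator S (x + a) * bitIndicator S y * bitIndicator S z) := by
  have hs : (Real.sqrt (S.card : ℝ))⁻¹ ^ 8 = ((S.card : ℝ) ^ 4)⁻¹ := by
    rw [inv_pow, show (8 : ℕ) = 2 * 4 from rfl, pow_mul, Real.sq_sqrt (Nat.cast_nonneg _)]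
  simp only [purityTerm, abs_mul, abs_subsetPhaseAmplitude]
  rw [← hs]
  set c := (Real.sqrt (S.card : ℝ))⁻¹
  have hprod : bitIndicator S (y + a) * bitIndicator S (z + a) * bitIndicator S (x + y + z) *
      bitIndicator S (x + y + z + a) ≤ 1 := by
    refine mul_le_one₀ (mul_le_one₀ (mul_le_one₀ ?_ ?_ ?_) ?_ ?_) ?_ ?_ <;>
      first | exact bitIndicator_le_one _ _ | exact bitIndicator_nonneg _ _
  have hnn : 0 ≤ c ^ 8 * (bitIndicator S x * bitIndicator S (x + a) * bitIndicator S y *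
      bitIndicator S z) :=
    mul_nonneg (by positivity) (mul_nonneg (mul_nonneg (mul_nonneg (bitIndicator_nonneg _ _)
      (bitIndicator_nonneg _ _)) (bitIndicator_nonneg _ _)) (bitIndicator_nonneg _ _))
  calc _ = c ^ 8 * (bitIndicator S x * bitIndicator S (x + a) * bitIndicator S y *
      bitIndicator S z) * (bitIndicator S (y + a) * bitIndicator S (z + a) *
      bitIndicator S (x + y + z) * bitIndicator S (x + y + z + a)) := by ring
    _ ≤ _ := mul_le_of_le_one_right hnn hprod

/-- If the point `x` occurs only once among the eight points, the average over the phases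
vanishes. -/
theorem sum_purityTerm_eq_zero (S : Finset (BitString n)) {a x y z : BitString n}
    (ha : a ≠ 0) (h1 : y ≠ x) (h2 : y ≠ x + a) (h3 : z ≠ x) (h4 : z ≠ x + a)
    (h5 : z ≠ y) (h6 : z ≠ y + a) :
    ∑ f, purityTerm (subsetPhaseAmplitude S f) a x y z = 0 := by
  -- Flipping the phase at `x` alone permutes the phase functions and negates the term, because the
  -- other seven points differ from `x`.
  have e := Equiv.sum_comp (Equiv.addRight (Pi.single x (1 : Fin 2)))
    fun f => purityTerm (subsetPhaseAmplitude S f) a x y z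
  have hxa : x + a ≠ x := by simpa using ha
  have hya : y + a ≠ x := fun h => h2 (BitString.eq_add_iff.1 h.symm)
  have hza : z + a ≠ x := fun h => h4 (BitString.eq_add_iff.1 h.symm)
  have hw : x + y + z ≠ x := by
    rw [add_assoc, Ne, add_eq_left, BitString.add_eq_zero_iff]
    exact h5.symm
  have hwa : x + y + z + a ≠ x := by
    rw [add_assoc, add_assoc, Ne, add_eq_left, BitString.add_eq_zero_iff]
    exact fun h => h6 (BitString.eq_add_iff.1 h)
  have hneg : ∀ f, purityTerm (subsetPhaseAmplitude S
      (Equiv.addRight (Pi.single x (1 : Fin 2)) f)) a x y z =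
      -purityTerm (subsetPhaseAmplitude S f) a x y z := by
    intro f
    simp only [purityTerm, Equiv.coe_addRight, subsetPhaseAmplitude_add_single, if_true,
      if_neg hxa, if_neg hya, if_neg hza, if_neg hw, if_neg hwa, if_neg h1, if_neg h3]
    ring
  simp_rw [hneg, Finset.sum_neg_distrib] at e
  linarith

/-- The number of coincidences that prevent the average over the phases from vanishing. -/
noncomputable def coincidences (a x y z : BitString n) : ℝ :=
  (if a = 0 then 1 else 0) + (if y = x then 1 else 0) + (if y = x + a then 1 else 0) +
    (if z = x then 1 else 0) + (if z = x + a then 1 else 0) + (if z = y then 1 else 0) +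
    (if z = y + a then 1 else 0)

/-- Without a coincidence the sum vanishes; otherwise `coincidences` is at least 1 and the absolute
bound suffices. Counting with multiplicity acts as a union bound. -/
theorem sum_purityTerm_le (S : Finset (BitString n)) (a x y z : BitString n) :
    ∑ f, purityTerm (subsetPhaseAmplitude S f) a x y z ≤
      (Fintype.card (BitString n → Fin 2) : ℝ) * (((S.card : ℝ) ^ 4)⁻¹ *
        (bitIndicator S x * bitIndicator S (x + a) * bitIndicator S y * bitIndicator S z *
          coincidences a x y z)) := by
  set B := bitIndicator S x * bitIndicator S (x + a) * bitIndicator S y * bitIndicator S z with hB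
  have hBnn : 0 ≤ B := mul_nonneg (mul_nonneg (mul_nonneg (bitIndicator_nonneg _ _)
      (bitIndicator_nonneg _ _)) (bitIndicator_nonneg _ _)) (bitIndicator_nonneg _ _)
  have hpart : ∀ p : Prop, ∀ [Decidable p], (0 : ℝ) ≤ if p then 1 else 0 := by
    intro p _; split_ifs <;> norm_num
  have hcnn : 0 ≤ coincidences a x y z := by
    unfold coincidences
    have := hpart (a = 0); have := hpart (y = x); have := hpart (y = x + a)
    have := hpart (z = x); have := hpart (z = x + a); have := hpart (z = y)
    have := hpart (z = y + a)
    linarith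
  by_cases h : a ≠ 0 ∧ y ≠ x ∧ y ≠ x + a ∧ z ≠ x ∧ z ≠ x + a ∧ z ≠ y ∧ z ≠ y + a
  · obtain ⟨ha, h1, h2, h3, h4, h5, h6⟩ := h
    rw [sum_purityTerm_eq_zero S ha h1 h2 h3 h4 h5 h6]
    positivity
  · have hc : 1 ≤ coincidences a x y z := by
      unfold coincidences
      have := hpart (a = 0); have := hpart (y = x); have := hpart (y = x + a)
      have := hpart (z = x); have := hpart (z = x + a); have := hpart (z = y)
      have := hpart (z = y + a)
      by_contra hlt
      apply h
      refine ⟨?_, ?_, ?_, ?_, ?_, ?_, ?_⟩ <;>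
      · intro heq
        apply hlt
        rw [if_pos heq]
        linarith
    have hb : ∀ f ∈ (Finset.univ : Finset (BitString n → Fin 2)),
        purityTerm (subsetPhaseAmplitude S f) a x y z ≤
          ((S.card : ℝ) ^ 4)⁻¹ * (B * coincidences a x y z) := by
      intro f _
      refine (le_abs_self _).trans ((abs_purityTerm_le S f a x y z).trans ?_)
      rw [← hB]
      gcongr
      exact le_mul_of_one_le_right hBnn hc
    refine (Finset.sum_le_card_nsmul _ _ _ hb).trans (le_of_eq ?_)
    rw [nsmul_eq_mul, Finset.card_univ]

theorem sum_bitIndicator_mul_add (S : Finset (BitString n)) :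
    ∑ a, ∑ x, bitIndicator S x * bitIndicator S (x + a) = (S.card : ℝ) ^ 2 := by
  rw [Finset.sum_comm, sq, ← sum_bitIndicator, Finset.sum_mul]
  refine Finset.sum_congr rfl fun x _ => ?_
  rw [← Finset.mul_sum]
  congr 1
  exact Equiv.sum_comp (Equiv.addLeft x) (bitIndicator S)

theorem sum_indicator_ite_zero_le (S : Finset (BitString n)) :
    ∑ a, ∑ x, ∑ y, ∑ z, bitIndicator S x * bitIndicator S (x + a) * bitIndicator S y *
      bitIndicator S z * (if a = 0 then 1 else 0) ≤ (S.card : ℝ) ^ 3 := by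
  rw [Finset.sum_eq_single (0 : BitString n) (fun a _ ha => by simp [ha]) (by simp)]
  simp only [add_zero, if_true, mul_one, ← Finset.mul_sum, sum_bitIndicator, ← Finset.sum_mul]
  have : ∀ x, bitIndicator S x * bitIndicator S x = bitIndicator S x := fun x => by
    unfold bitIndicator; split_ifs <;> norm_num
  simp only [this, sum_bitIndicator]
  exact le_of_eq (by ring)

/-- Unconstrained, the indicators sum to `K⁴`; fixing `y` in terms of `a` and `x` saves a factor
`K`. A general `w` covers both `y = x` and `y = x + a`. -/
theorem sum_indicator_ite_third_le (S : Finset (BitString n))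
    (w : BitString n → BitString n → BitString n) :
    ∑ a, ∑ x, ∑ y, ∑ z, bitIndicator S x * bitIndicator S (x + a) * bitIndicator S y *
      bitIndicator S z * (if y = w a x then 1 else 0) ≤ (S.card : ℝ) ^ 3 := by
  have h : ∀ a x : BitString n, ∑ y, ∑ z, bitIndicator S x * bitIndicator S (x + a) *
      bitIndicator S y * bitIndicator S z * (if y = w a x then 1 else 0) ≤
      bitIndicator S x * bitIndicator S (x + a) * S.card := by
    intro a x
    simp only [mul_ite, mul_one, mul_zero]
    rw [Finset.sum_eq_single (w a x) (fun y _ hy => by simp [hy]) (by simp)]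
    simp only [if_true, ← Finset.mul_sum, sum_bitIndicator]
    refine mul_le_mul_of_nonneg_right ?_ (Nat.cast_nonneg _)
    exact mul_le_of_le_one_right (mul_nonneg (bitIndicator_nonneg _ _) (bitIndicator_nonneg _ _))
      (bitIndicator_le_one _ _)
  refine (Finset.sum_le_sum fun a _ => Finset.sum_le_sum fun x _ => h a x).trans ?_
  simp_rw [← Finset.sum_mul]
  rw [sum_bitIndicator_mul_add]
  exact le_of_eq (by ring)

theorem sum_indicator_ite_fourth_le (S : Finset (BitString n))
    (w : BitString n → BitString n → BitString n → BitString n) :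
    ∑ a, ∑ x, ∑ y, ∑ z, bitIndicator S x * bitIndicator S (x + a) * bitIndicator S y *
      bitIndicator S z * (if z = w a x y then 1 else 0) ≤ (S.card : ℝ) ^ 3 := by
  have h : ∀ a x y : BitString n, ∑ z, bitIndicator S x * bitIndicator S (x + a) *
      bitIndicator S y * bitIndicator S z * (if z = w a x y then 1 else 0) ≤
      bitIndicator S x * bitIndicator S (x + a) * bitIndicator S y := by
    intro a x y
    simp only [mul_ite, mul_one, mul_zero]
    rw [Finset.sum_eq_single (w a x y) (fun y _ hy => by simp [hy]) (by simp)]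
    simp only [if_true]
    exact mul_le_of_le_one_right (mul_nonneg (mul_nonneg (bitIndicator_nonneg _ _)
      (bitIndicator_nonneg _ _)) (bitIndicator_nonneg _ _)) (bitIndicator_le_one _ _)
  refine (Finset.sum_le_sum fun a _ => Finset.sum_le_sum fun x _ =>
    Finset.sum_le_sum fun y _ => h a x y).trans ?_
  simp_rw [← Finset.mul_sum, sum_bitIndicator, ← Finset.sum_mul]
  rw [sum_bitIndicator_mul_add]
  exact le_of_eq (by ring)

/-- The stabilizer purity, averaged over the phases, is at most `7 / K`. -/
theorem sum_stabilizerPurity_le {S : Finset (BitString n)} (hS : S.Nonempty) :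
    ∑ f, stabilizerPurity (subsetPhaseAmplitude S f) ≤
      (Fintype.card (BitString n → Fin 2) : ℝ) * (7 / S.card) := by
  have hK : (0 : ℝ) < S.card := by exact_mod_cast hS.card_pos
  have hswap : ∑ f, stabilizerPurity (subsetPhaseAmplitude S f) =
      ∑ a, ∑ x, ∑ y, ∑ z, ∑ f, purityTerm (subsetPhaseAmplitude S f) a x y z := by
    unfold stabilizerPurity
    rw [Finset.sum_comm]
    refine Finset.sum_congr rfl fun a _ => ?_
    rw [Finset.sum_comm]
    refine Finset.sum_congr rfl fun x _ => ?_
    rw [Finset.sum_comm]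
    refine Finset.sum_congr rfl fun y _ => ?_
    rw [Finset.sum_comm]
    rfl
  rw [hswap]
  refine (Finset.sum_le_sum fun a _ => Finset.sum_le_sum fun x _ => Finset.sum_le_sum fun y _ =>
    Finset.sum_le_sum fun z _ => sum_purityTerm_le S a x y z).trans ?_
  simp_rw [← Finset.mul_sum]
  gcongr
  have hsum : ∑ a, ∑ x, ∑ y, ∑ z, bitIndicator S x * bitIndicator S (x + a) *
      bitIndicator S y * bitIndicator S z * coincidences a x y z ≤ 7 * (S.card : ℝ) ^ 3 := by
    simp_rw [coincidences, mul_add, Finset.sum_add_distrib]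
    have h0 := sum_indicator_ite_zero_le S
    have h1 := sum_indicator_ite_third_le S fun _ x => x
    have h2 := sum_indicator_ite_third_le S fun a x => x + a
    have h3 := sum_indicator_ite_fourth_le S fun _ x _ => x
    have h4 := sum_indicator_ite_fourth_le S fun a x _ => x + a
    have h5 := sum_indicator_ite_fourth_le S fun _ _ y => y
    have h6 := sum_indicator_ite_fourth_le S fun a _ y => y + a
    linarith
  calc _ ≤ ((S.card : ℝ) ^ 4)⁻¹ * (7 * (S.card : ℝ) ^ 3) := by gcongr
    _ = 7 / S.card := by field_simp

/-- Jensen's inequality for the binary logarithm and a uniform average. -/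
theorem card_mul_neg_logb_le {ι : Type*} [Fintype ι] {W : ι → ℝ} (hW : ∀ i, 0 < W i) {c : ℝ}
    (hc : 0 < c) (hsum : ∑ i, W i ≤ Fintype.card ι * c) :
    Fintype.card ι * -Real.logb 2 c ≤ ∑ i, -Real.logb 2 (W i) := by
  have h2 : 0 < Real.log 2 := Real.log_pos (by norm_num)
  -- Tangent line of the logarithm at `c`; its linear part has nonpositive total over `i`.
  have h : ∀ i, -Real.logb 2 c - (W i / c - 1) / Real.log 2 ≤ -Real.logb 2 (W i) := by
    intro i
    have := Real.log_le_sub_one_of_pos (div_pos (hW i) hc)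
    rw [Real.log_div (hW i).ne' hc.ne'] at this
    rw [Real.logb, Real.logb, ← neg_div, ← neg_div, ← sub_div]
    gcongr
    linarith
  refine le_trans ?_ (Finset.sum_le_sum fun i _ => h i)
  rw [Finset.sum_sub_distrib, ← Finset.sum_div, Finset.sum_sub_distrib, ← Finset.sum_div]
  simp only [Finset.sum_const, Finset.card_univ, nsmul_eq_mul, mul_one]
  have h3 : (∑ i, W i) / c ≤ Fintype.card ι := by rwa [div_le_iff₀ hc]
  have h4 : ((∑ i, W i) / c - Fintype.card ι) / Real.log 2 ≤ 0 :=
    div_nonpos_of_nonpos_of_nonneg (by linarith) h2.le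
  linarith

theorem card_mul_le_sum_stabilizerRenyiEntropy {S : Finset (BitString n)} (hS : S.Nonempty)
    (α : ℝ) :
    (Fintype.card (BitString n → Fin 2) : ℝ) *
        (collisionFactor α * (Real.logb 2 S.card - Real.logb 2 7)) ≤
      ∑ f, stabilizerRenyiEntropy α (subsetPhaseState S f) := by
  have hK : (0 : ℝ) < S.card := by exact_mod_cast hS.card_pos
  have h := card_mul_neg_logb_le (W := fun f => stabilizerPurity (subsetPhaseAmplitude S f))
    (fun f => stabilizerPurity_pos (sum_subsetPhaseAmplitude_sq hS f))
    (show (0 : ℝ) < 7 / S.card by positivity) (sum_stabilizerPurity_le hS)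
  have h' := mul_le_mul_of_nonneg_left h (collisionFactor_pos α).le
  rw [Finset.mul_sum, Real.logb_div (by norm_num) hK.ne'] at h'
  calc _ = _ := by ring
    _ ≤ _ := h'
    _ ≤ _ := Finset.sum_le_sum fun f _ => by
      have hf := sum_subsetPhaseAmplitude_sq hS f
      rw [subsetPhaseState_eq, ← stabilizerRenyiEntropy_two hf]
      exact collisionFactor_mul_le hf (bitCorrelation_sq_le_one hf) α

end RandomPhase

/-! ### Averages over the ensemble -/

theorem card_powersetCard_pos {n K : ℕ} (hK : K ≤ 2 ^ n) :
    0 < (Finset.powersetCard K (Finset.univ : Finset (BitString n))).card := by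
  rw [Finset.card_powersetCard]
  exact Nat.choose_pos (by simpa using hK)

theorem le_rspExpectation {n K : ℕ} (hK : K ≤ 2 ^ n) {F : QubitVector n → ℝ} {B : ℝ}
    (h : ∀ S : Finset (BitString n), S.card = K →
      (Fintype.card (BitString n → Fin 2) : ℝ) * B ≤ ∑ f, F (subsetPhaseState S f)) :
    B ≤ rspExpectation n K F := by
  have h1 : (0 : ℝ) < (Finset.powersetCard K (Finset.univ : Finset (BitString n))).card := by
    exact_mod_cast card_powersetCard_pos hK
  have h2 : (0 : ℝ) < Fintype.card (BitString n → Fin 2) := by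
    exact_mod_cast Fintype.card_pos
  rw [rspExpectation, le_div_iff₀ (mul_pos h1 h2)]
  have h3 := Finset.card_nsmul_le_sum _ _ _ fun S hS => h S (Finset.mem_powersetCard_univ.1 hS)
  rw [nsmul_eq_mul] at h3
  linarith

theorem rspExpectation_le {n K : ℕ} (hK : K ≤ 2 ^ n) {F : QubitVector n → ℝ} {B : ℝ}
    (h : ∀ S : Finset (BitString n), S.card = K → ∀ f, F (subsetPhaseState S f) ≤ B) :
    rspExpectation n K F ≤ B := by
  have h1 : (0 : ℝ) < (Finset.powersetCard K (Finset.univ : Finset (BitString n))).card := by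
    exact_mod_cast card_powersetCard_pos hK
  have h2 : (0 : ℝ) < Fintype.card (BitString n → Fin 2) := by
    exact_mod_cast Fintype.card_pos
  rw [rspExpectation, div_le_iff₀ (mul_pos h1 h2)]
  have h3 := Finset.sum_le_card_nsmul _ (fun S => ∑ f, F (subsetPhaseState S f)) _ fun S hS =>
    Finset.sum_le_card_nsmul Finset.univ _ _ fun f _ =>
      h S (Finset.mem_powersetCard_univ.1 hS) f
  simp only [nsmul_eq_mul, Finset.card_univ] at h3
  linarith

theorem mainTheorem8 (c₁ c₂ : ℝ) (hc₁ : 0 < c₁) (hc : c₁ ≤ c₂) :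
    (∀ α : ℝ, 0 ≤ α → ∃ a b R : ℝ, 0 < a ∧ 0 < b ∧
      ∀ (n t K : ℕ) (ε : ℝ), 1 ≤ t → 0 < ε → ε ≤ 1 → K ≤ 2 ^ n →
        (2 : ℝ) ^ (c₁ * Real.logb 2 (t / ε)) ≤ K →
        (K : ℝ) ≤ (2 : ℝ) ^ (c₂ * Real.logb 2 (t / ε)) →
        rspExpectation n K (stabilizerRenyiEntropy α) ≤ b * Real.logb 2 (t / ε) ∧
        (R ≤ t / ε →
          a * Real.logb 2 (t / ε) ≤ rspExpectation n K (stabilizerRenyiEntropy α))) ∧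
    (∃ d : ℝ, 0 < d ∧
      ∀ (n t K : ℕ) (ε : ℝ), 1 ≤ t → 0 < ε → ε ≤ 1 → K ≤ 2 ^ n →
        (2 : ℝ) ^ (c₁ * Real.logb 2 (t / ε)) ≤ K →
        (K : ℝ) ≤ (2 : ℝ) ^ (c₂ * Real.logb 2 (t / ε)) →
        d * Real.logb 2 (t / ε) ≤ rspExpectation n K pureCoherence) := by

  have hlog : ∀ (n t K : ℕ) (ε : ℝ), (2 : ℝ) ^ (c₁ * Real.logb 2 (t / ε)) ≤ K →
      (K : ℝ) ≤ (2 : ℝ) ^ (c₂ * Real.logb 2 (t / ε)) → 0 < K ∧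
      c₁ * Real.logb 2 (t / ε) ≤ Real.logb 2 K ∧ Real.logb 2 K ≤ c₂ * Real.logb 2 (t / ε) := by
    intro n t K ε h1 h2
    have hK : (0 : ℝ) < K := lt_of_lt_of_le (by positivity) h1
    exact ⟨by exact_mod_cast hK, (Real.le_logb_iff_rpow_le (by norm_num) hK).2 h1,
      (Real.logb_le_iff_le_rpow (by norm_num) hK).2 h2⟩
  have hne : ∀ (n K : ℕ) (S : Finset (BitString n)), 0 < K → S.card = K → S.Nonempty :=
    fun n K S hK hS => Finset.card_pos.1 (hS ▸ hK)
  -- Above this threshold `log 7 ≤ (c₁ / 2) log (t / ε)`, so the loss of `log 7` costs at most half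
  -- of `c₁ log (t / ε)`.
  refine ⟨fun α hα => ⟨collisionFactor α * (c₁ / 2), 2 * c₂, (2 : ℝ) ^ (2 * Real.logb 2 7 / c₁),
    mul_pos (collisionFactor_pos α) (by linarith), by linarith, ?_⟩, c₁, hc₁, ?_⟩
  · intro n t K ε ht hε hε1 hKn h1 h2
    obtain ⟨hK, hl1, hl2⟩ := hlog n t K ε h1 h2
    refine ⟨?_, fun hR => ?_⟩
    · refine rspExpectation_le hKn fun S hS f => ?_
      have hf := sum_subsetPhaseAmplitude_sq (hne n K S hK hS) f
      rw [subsetPhaseState_eq]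
      refine (stabilizerRenyiEntropy_le hf (subsetPhaseAmplitude_of_notMem f) hα).trans ?_
      rw [hS]
      linarith
    · have htε : (0 : ℝ) < t / ε := div_pos (by exact_mod_cast ht) hε
      have hL := (Real.le_logb_iff_rpow_le (by norm_num) htε).2 hR
      rw [div_le_iff₀ hc₁] at hL
      refine le_trans ?_ (le_rspExpectation hKn fun S hS =>
        hS ▸ card_mul_le_sum_stabilizerRenyiEntropy (hne n K S hK hS) α)
      rw [mul_assoc]
      refine mul_le_mul_of_nonneg_left ?_ (collisionFactor_pos α).le
      linarith
  · intro n t K ε ht hε hε1 hKn h1 h2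
    obtain ⟨hK, hl1, -⟩ := hlog n t K ε h1 h2
    refine hl1.trans (le_rspExpectation hKn fun S hS => ?_)
    simp_rw [pureCoherence_subsetPhaseState (hne n K S hK hS), hS]
    simp
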